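/- **Theorem.** For permutations written in one-line notation, let $\mathrm{occr}_\gamma(\sigma)$ be the number of occurrences of the pattern $\gamma$ in $\sigma$ (subsequences of $\sigma$ in the same relative order as $\gamma$), let $\mathcal S_n(132)$ be the set of permutations of length $n$ with no occurrence of $132$, and let $\mathrm{coinv}(\sigma)=|\{(a,b): a<b,\ \sigma_a<\sigma_b\}|$. Let $(\gamma_1,\dots,\gamma_5)=(123,213,231,312,321)$ and $(\delta_1,\dots,\delta_{14})=(1234,2134,2314,2341,3124,3214,3241,3412,3421,4123,4213,4231,4312,4321)$. For $n\ge 0$ and $i\in\mathbb Z$ define the polynomial $$Q_{n,i}(x_1,\dots,x_5,y_1,\dots,y_{14})=\sum_{\substack{\sigma\in\mathcal S_n(132)\\ \mathrm{coinv}(\sigma)=i}}\ \prod_{a=1}^{5}x_a^{\mathrm{occr}_{\gamma_a}(\sigma)}\prod_{b=1}^{14}y_b^{\mathrm{occr}_{\delta_b}(\sigma)} .$$ Then $Q_{0,0}=1$; $Q_{n,i}=0$ for $i<0$ or $i>\binom n2$; and for all $n\ge 1$ and all $i\in\mathbb Z$, with the abbreviations (for given $k,j$) $$h=n-k,\qquad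 \ell=i+1-k-j,\qquad c=\binom{k-1}{2}-j,\qquad d=\binom{n-k}{2}-\ell=\binom{n-k}{2}+k+j-i-1,$$ one has $$\begin{aligned} Q_{n,i}(x_1,\dots,x_5,y_1,\dots,y_{14})=\sum_{k=1}^{n}\ \sum_{j=0}^{i+1-k}\ & x_1^{\,j}\,x_2^{\,c}\,x_3^{\,h(k+j-1)}\,x_4^{\,k\ell}\,x_5^{\,hc+kd}\,y_4^{\,jh}\,y_7^{\,ch}\,y_8^{\,(j+k-1)\ell}\,y_9^{\,(j+k-1)d}\,y_{13}^{\,c\ell}\,y_{14}^{\,cd}\\ &\cdot Q_{k-1,\,j}\bigl(x_1y_1y_4^{h},\,x_2y_2y_7^{h},\,x_3y_3y_9^{h},\,x_4y_5y_{12}^{h},\,x_5y_6y_{14}^{h},\,y_1,\dots,y_{14}\bigr)\\ &\cdot Q_{n-k,\,\ell}\bigl(x_1y_{10}^{k},\,x_2y_{11}^{k},\,x_3y_{12}^{k},\,x_4y_{13}^{k},\,x_5y_{14}^{k},\,y_1,\dots,y_{14}\bigr). \end{aligned}$$ Here the inner sum is empty when $i+1-k<0$, and a term with $c<0$ or $d<0$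 (in which one of the two $Q$ factors is $0$) is $0$. -/

import Mathlib

open Finset

/-- The number of occurrences of a pattern `p = p₁ ⋯ p_m` (written in one-line notation, with
distinct letters) in a permutation `σ` of `{0, …, n - 1}`: the number of choices of positions
`f 0 < ⋯ < f (m - 1)` such that the values of `σ` at these positions are in the same relative
order as the letters of `p`. -/
def occr {m n : ℕ} (p : Fin m → ℕ) (σ : Equiv.Perm (Fin n)) : ℕ :=
  #{f : Fin m → Fin n |
    (∀ a b, a < b → f a < f b) ∧ ∀ a b, σ (f a) < σ (f b) ↔ p a < p b}

/-- The number of coinversions: pairs of positions `a < b` with `σ a < σ b`. -/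
def coinv {n : ℕ} (σ : Equiv.Perm (Fin n)) : ℕ :=
  #{q : Fin n × Fin n | q.1 < q.2 ∧ σ q.1 < σ q.2}

/-- The set `S_n(132)` of permutations of length `n` that avoid the pattern `132`. -/
def avoid132 (n : ℕ) : Finset (Equiv.Perm (Fin n)) :=
  {σ | occr ![1, 3, 2] σ = 0}

/-- The five patterns of length three in `S_3(132)`, tracked by `x₁, …, x₅` in this order. -/
def pattern3 : Fin 5 → Fin 3 → ℕ :=
  ![![1, 2, 3], ![2, 1, 3], ![2, 3, 1], ![3, 1, 2], ![3, 2, 1]]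

/-- The fourteen patterns of length four in `S_4(132)`, tracked by `y₁, …, y₁₄` in this order. -/
def pattern4 : Fin 14 → Fin 4 → ℕ :=
  ![![1, 2, 3, 4], ![2, 1, 3, 4], ![2, 3, 1, 4], ![2, 3, 4, 1], ![3, 1, 2, 4],
    ![3, 2, 1, 4], ![3, 2, 4, 1], ![3, 4, 1, 2], ![3, 4, 2, 1], ![4, 1, 2, 3],
    ![4, 2, 1, 3], ![4, 2, 3, 1], ![4, 3, 1, 2], ![4, 3, 2, 1]]

/-- The polynomial `Q_{n,i}(x₁, …, x₅, y₁, …, y₁₄)`: the generating function, over the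
permutations in `S_n(132)` with exactly `i` coinversions, of the numbers of occurrences of the five
patterns of length three (variables `X (Sum.inl a)`) and of the fourteen patterns of length four
(variables `X (Sum.inr b)`). The index `i` is an integer. -/
noncomputable def Qpoly (n : ℕ) (i : ℤ) : MvPolynomial (Fin 5 ⊕ Fin 14) ℤ :=
  ∑ σ ∈ avoid132 n with (coinv σ : ℤ) = i,
    (∏ a : Fin 5, MvPolynomial.X (Sum.inl a) ^ occr (pattern3 a) σ) *
      ∏ b : Fin 14, MvPolynomial.X (Sum.inr b) ^ occr (pattern4 b) σ

/-- The polynomial `Q_{n,i}` evaluated at elements of a commutative ring. -/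
noncomputable def Qeval {R : Type*} [CommRing R] (n : ℕ) (i : ℤ) (x : Fin 5 → R)
    (y : Fin 14 → R) : R :=
  MvPolynomial.aeval (Sum.elim x y) (Qpoly n i)

/-! Cut a 132-avoiding permutation at its maximum. Every letter before the maximum exceeds every
letter after it, so the permutation is `joinPerm τ ρ` with `τ` of length `k - 1` and `ρ` of length
`n - k`, both avoiding 132; conversely every such pair occurs (`exists_joinPerm_eq`,
`occr_132_joinPerm`). Across a cut where one side dominates the other, an occurrence of a pattern is
a prefix on the left and the remaining suffix on the right, chosen independently, provided the two
pieces of the pattern compare the same way. Cutting after the maximum, then just before it,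
expresses each count for `joinPerm τ ρ` through counts for `τ` and `ρ` (`occr_joinPerm_three`,
`occr_joinPerm_four`). Crossing terms linear in a length-three count alter the arguments of a `Q`
factor; those using only lengths and counts of 12 and 21 form the monomial prefactor
(`permWeight_joinPerm`). The maximum adds `k - 1` coinversions, so fixing `j` for `τ` forces `i + 1
- k - j` for `ρ`, and the sum factors. -/

/-- The number of occurrences of the pattern `p` in a word `w` of natural numbers. -/
def wordOcc {m n : ℕ} (p : Fin m → ℕ) (w : Fin n → ℕ) : ℕ :=
  #{f : Fin m → Fin n |
    (∀ a b, a < b → f a < f b) ∧ ∀ a b, w (f a) < w (f b) ↔ p a < p b}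

theorem occr_eq_wordOcc {m n : ℕ} (p : Fin m → ℕ) (σ : Equiv.Perm (Fin n)) :
    occr p σ = wordOcc p (fun i => (σ i : ℕ)) := rfl

theorem wordOcc_congr {m n : ℕ} {p q : Fin m → ℕ} {v w : Fin n → ℕ}
    (hp : ∀ a b, p a < p b ↔ q a < q b) (hw : ∀ a b, v a < v b ↔ w a < w b) :
    wordOcc p v = wordOcc q w := by
  simp only [wordOcc, hp, hw]

theorem wordOcc_congr_pattern {m n : ℕ} {p : Fin m → ℕ} (q : Fin m → ℕ) {w : Fin n → ℕ}
    (hp : ∀ a b, p a < p b ↔ q a < q b) : wordOcc p w = wordOcc q w :=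
  wordOcc_congr hp fun _ _ => Iff.rfl

theorem wordOcc_zero {n : ℕ} (p : Fin 0 → ℕ) (w : Fin n → ℕ) : wordOcc p w = 1 := by
  simp [wordOcc]

theorem wordOcc_one {n : ℕ} (p : Fin 1 → ℕ) (w : Fin n → ℕ) : wordOcc p w = n := by
  simp [wordOcc, Subsingleton.elim _ (0 : Fin 1)]

theorem wordOcc_eq_zero_of_lt {m n : ℕ} (h : n < m) (p : Fin m → ℕ) (w : Fin n → ℕ) :
    wordOcc p w = 0 := by
  rw [wordOcc, Finset.card_eq_zero, Finset.filter_eq_empty_iff]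
  rintro f - ⟨hf, -⟩
  have := Fintype.card_le_of_injective f (StrictMono.injective (fun a b => hf a b))
  simp only [Fintype.card_fin] at this
  omega

/-! ### Splitting occurrences at a cut of the word -/

/-- The occurrences of a pattern in a word of length `a + b` in which exactly the first `s`
letters of the pattern are taken from the first `a` letters of the word. -/
def splitOcc {m a b : ℕ} (s : ℕ) (p : Fin m → ℕ) (w : Fin (a + b) → ℕ) : ℕ :=
  #{f : Fin m → Fin (a + b) | ((∀ x y, x < y → f x < f y) ∧
    ∀ x y, w (f x) < w (f y) ↔ p x < p y) ∧ ∀ x, (f x : ℕ) < a ↔ (x : ℕ) < s}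

/-- Since `f` is increasing, the indices sent below `a` form an initial segment; `s` is the first
index sent to `a` or beyond, or `m` if there is none. -/
theorem exists_split {m a N : ℕ} {f : Fin m → Fin N} (hf : ∀ x y, x < y → f x < f y) :
    ∃ s ≤ m, ∀ x, (f x : ℕ) < a ↔ (x : ℕ) < s := by
  classical
  by_cases h : ∃ s, ∃ hs : s < m, a ≤ f ⟨s, hs⟩
  · obtain ⟨hs, has⟩ := Nat.find_spec h
    refine ⟨Nat.find h, hs.le, fun x => ⟨fun hx => ?_, fun hx => ?_⟩⟩
    · by_contra hlt
      rcases (not_lt.mp hlt).eq_or_lt with he | hl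
      · have : x = ⟨Nat.find h, hs⟩ := Fin.ext he.symm
        rw [this] at hx; omega
      · have := hf ⟨Nat.find h, hs⟩ x hl
        rw [Fin.lt_def] at this; omega
    · have := Nat.find_min h hx
      push Not at this
      exact this x.2
  · push Not at h
    exact ⟨m, le_rfl, fun x => ⟨fun _ => x.2, fun _ => h x x.2⟩⟩

theorem wordOcc_eq_sum_splitOcc {m a b : ℕ} (p : Fin m → ℕ) (w : Fin (a + b) → ℕ) :
    wordOcc p w = ∑ s ∈ range (m + 1), splitOcc s p w := by
  classical
  simp only [splitOcc, wordOcc]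
  rw [← Finset.card_biUnion]
  · congr 1
    ext f
    simp only [mem_filter, mem_univ, true_and, mem_biUnion, mem_range]
    constructor
    · intro hf
      obtain ⟨s, hs, h⟩ := exists_split (a := a) hf.1
      exact ⟨s, by omega, hf, h⟩
    · rintro ⟨s, -, hf, -⟩
      exact hf
  · intro s hs t ht hst
    rw [Function.onFun, Finset.disjoint_left]
    intro f hf hf'
    simp only [mem_filter, mem_univ, true_and] at hf hf'
    simp only [coe_range, Set.mem_Iio] at hs ht
    rcases lt_or_gt_of_ne hst with h | h
    · have h1 := hf.2 ⟨s, by omega⟩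
      have h2 := hf'.2 ⟨s, by omega⟩
      simp only at h1 h2
      omega
    · have h1 := hf.2 ⟨t, by omega⟩
      have h2 := hf'.2 ⟨t, by omega⟩
      simp only at h1 h2
      omega

/-- All comparisons across the cut have one truth value `D`: true if the left letters are smaller,
false if they are larger. A pattern whose two pieces compare otherwise cannot straddle the cut. -/
theorem splitOcc_eq_zero {s t a b : ℕ} {p : Fin (s + t) → ℕ} {w : Fin (a + b) → ℕ} {D : Prop}
    (hlt : ∀ i j, w (Fin.castAdd b i) < w (Fin.natAdd a j) ↔ D)
    (hgt : ∀ i j, w (Fin.natAdd a j) < w (Fin.castAdd b i) ↔ ¬ D)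
    (hp : ¬ ∀ x y, (p (Fin.castAdd t x) < p (Fin.natAdd s y) ↔ D) ∧
      (p (Fin.natAdd s y) < p (Fin.castAdd t x) ↔ ¬ D)) :
    splitOcc s p w = 0 := by
  rw [splitOcc, Finset.card_eq_zero, Finset.filter_eq_empty_iff]
  rintro f - ⟨⟨-, hf⟩, hs⟩
  refine hp fun x y => ?_
  have hx := (hs (Fin.castAdd t x)).2 (by simp)
  have hy := mt (hs (Fin.natAdd s y)).1 (by simp)
  rw [← hf, ← hf]
  obtain ⟨i, hi⟩ : ∃ i, f (Fin.castAdd t x) = Fin.castAdd b i := ⟨⟨_, hx⟩, rfl⟩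
  obtain ⟨j, hj⟩ : ∃ j, f (Fin.natAdd s y) = Fin.natAdd a j :=
    ⟨⟨f (Fin.natAdd s y) - a, by omega⟩, by ext; simp; omega⟩
  rw [hi, hj]
  exact ⟨hlt i j, hgt i j⟩

theorem splitOcc_eq_mul {s t a b : ℕ} {p : Fin (s + t) → ℕ} {w : Fin (a + b) → ℕ} {D : Prop}
    (hlt : ∀ i j, w (Fin.castAdd b i) < w (Fin.natAdd a j) ↔ D)
    (hgt : ∀ i j, w (Fin.natAdd a j) < w (Fin.castAdd b i) ↔ ¬ D)
    (hp : ∀ x y, (p (Fin.castAdd t x) < p (Fin.natAdd s y) ↔ D) ∧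
      (p (Fin.natAdd s y) < p (Fin.castAdd t x) ↔ ¬ D)) :
    splitOcc s p w = wordOcc (p ∘ Fin.castAdd t) (w ∘ Fin.castAdd b) *
      wordOcc (p ∘ Fin.natAdd s) (w ∘ Fin.natAdd a) := by
  rw [splitOcc, wordOcc, wordOcc, ← Finset.card_product]
  symm
  refine Finset.card_bij
    (fun f _ => Fin.addCases (fun x => Fin.castAdd b (f.1 x)) (fun y => Fin.natAdd a (f.2 y)))
    ?_ ?_ ?_
  · rintro ⟨f, g⟩ h
    simp only [mem_product, mem_filter, mem_univ, true_and, Function.comp] at h ⊢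
    obtain ⟨⟨h1, h2⟩, h3, h4⟩ := h
    refine ⟨⟨fun x y => ?_, fun x y => ?_⟩, fun x => ?_⟩
    · induction x using Fin.addCases <;> induction y using Fin.addCases <;>
        simp only [Fin.addCases_left, Fin.addCases_right, Fin.lt_def, Fin.val_castAdd,
          Fin.val_natAdd, add_lt_add_iff_left]
      · exact h1 _ _
      · intro; omega
      · intro; omega
      · exact h3 _ _
    · induction x using Fin.addCases <;> induction y using Fin.addCases <;>
        simp only [Fin.addCases_left, Fin.addCases_right]
      · exact h2 _ _
      · rw [hlt, (hp _ _).1]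
      · rw [hgt, (hp _ _).2]
      · exact h4 _ _
    · induction x using Fin.addCases <;> simp
  · rintro ⟨f, g⟩ - ⟨f', g'⟩ - h
    simp only [Prod.mk.injEq]
    constructor
    · ext x
      simpa using congrArg Fin.val (congrFun h (Fin.castAdd t x))
    · ext x
      simpa using congrArg Fin.val (congrFun h (Fin.natAdd s x))
  · intro f hf
    simp only [mem_filter, mem_univ, true_and] at hf
    obtain ⟨⟨h1, h2⟩, h3⟩ := hf
    have hl (x : Fin s) : (f (Fin.castAdd t x) : ℕ) < a := (h3 _).2 (by simp)
    have hr (y : Fin t) : a ≤ (f (Fin.natAdd s y) : ℕ) := not_lt.1 (mt (h3 _).1 (by simp))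
    let g : Fin s → Fin a := fun x => ⟨f (Fin.castAdd t x), hl x⟩
    let g' : Fin t → Fin b := fun y =>
      ⟨f (Fin.natAdd s y) - a, by have := (f (Fin.natAdd s y)).2; have := hr y; omega⟩
    have hg (x) : f (Fin.castAdd t x) = Fin.castAdd b (g x) := rfl
    have hg' (y) : f (Fin.natAdd s y) = Fin.natAdd a (g' y) := by
      ext
      have := hr y
      simp only [g', Fin.val_natAdd]
      omega
    refine ⟨(g, g'), ?_, ?_⟩
    · simp only [mem_product, mem_filter, mem_univ, true_and, Function.comp, ← hg, ← hg', h2,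
        implies_true, and_true]
      refine ⟨fun x y hxy => ?_, fun x y hxy => ?_⟩
      · have := h1 (Fin.castAdd t x) (Fin.castAdd t y) hxy
        rwa [hg, hg] at this
      · have := h1 (Fin.natAdd s x) (Fin.natAdd s y) (by simpa using hxy)
        rw [hg', hg'] at this
        simpa using this
    · funext x
      induction x using Fin.addCases <;> simp [hg, hg']

section Split
variable {a b : ℕ} {w : Fin (a + b) → ℕ} {D : Prop} [Decidable D]

theorem splitOcc_append {s t : ℕ} {p : Fin (s + t) → ℕ} (q : Fin s → ℕ) (r : Fin t → ℕ)
    (hp : p = Fin.append q r)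
    (hlt : ∀ i j, w (Fin.castAdd b i) < w (Fin.natAdd a j) ↔ D)
    (hgt : ∀ i j, w (Fin.natAdd a j) < w (Fin.castAdd b i) ↔ ¬ D) :
    splitOcc s p w = if ∀ x y, (q x < r y ↔ D) ∧ (r y < q x ↔ ¬ D) then
      wordOcc q (w ∘ Fin.castAdd b) * wordOcc r (w ∘ Fin.natAdd a) else 0 := by
  subst hp
  have hq : Fin.append q r ∘ Fin.castAdd t = q := by ext; simp
  have hr : Fin.append q r ∘ Fin.natAdd s = r := by ext; simp
  split_ifs with h
  · rw [splitOcc_eq_mul hlt hgt (by simpa using h), hq, hr]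
  · exact splitOcc_eq_zero hlt hgt (by simpa using h)

theorem splitOcc_zero {m : ℕ} (p : Fin m → ℕ)
    (hlt : ∀ i j, w (Fin.castAdd b i) < w (Fin.natAdd a j) ↔ D)
    (hgt : ∀ i j, w (Fin.natAdd a j) < w (Fin.castAdd b i) ↔ ¬ D) :
    splitOcc 0 p w = wordOcc p (w ∘ Fin.natAdd a) := by
  -- `0 + m` is not definitionally `m`, so the pattern is transported before `splitOcc_append` is
  -- applied with an empty prefix.
  have hm : ∀ m' (h : m' = m), splitOcc 0 (fun x : Fin m' => p (Fin.cast h x)) w =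
      splitOcc 0 p w := by rintro _ rfl; rfl
  rw [← hm (0 + m) (zero_add m), splitOcc_append ![] p _ hlt hgt, if_pos (fun x => x.elim0),
    wordOcc_zero, one_mul]
  ext x
  rw [Fin.append_left_nil _ _ rfl]
  rfl

theorem splitOcc_self {m : ℕ} (p : Fin m → ℕ)
    (hlt : ∀ i j, w (Fin.castAdd b i) < w (Fin.natAdd a j) ↔ D)
    (hgt : ∀ i j, w (Fin.natAdd a j) < w (Fin.castAdd b i) ↔ ¬ D) :
    splitOcc m p w = wordOcc p (w ∘ Fin.castAdd b) := by
  rw [splitOcc_append (s := m) (t := 0) p ![] _ hlt hgt, if_pos (fun _ y => y.elim0),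
    wordOcc_zero, mul_one]
  ext x
  rw [Fin.append_right_nil _ _ rfl]
  rfl

theorem wordOcc_two_split (hlt : ∀ i j, w (Fin.castAdd b i) < w (Fin.natAdd a j) ↔ D)
    (hgt : ∀ i j, w (Fin.natAdd a j) < w (Fin.castAdd b i) ↔ ¬ D) (p₀ p₁ : ℕ) :
    wordOcc ![p₀, p₁] w = wordOcc ![p₀, p₁] (w ∘ Fin.castAdd b) +
      (if (p₀ < p₁ ↔ D) ∧ (p₁ < p₀ ↔ ¬ D) then a * b else 0) +
      wordOcc ![p₀, p₁] (w ∘ Fin.natAdd a) := by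
  rw [wordOcc_eq_sum_splitOcc]
  simp only [sum_range_succ, range_zero, sum_empty, zero_add]
  rw [splitOcc_zero _ hlt hgt, splitOcc_self _ hlt hgt, splitOcc_append (s := 1) (t := 1) ![p₀]
    ![p₁] (by ext i; fin_cases i <;> rfl) hlt hgt]
  simp only [wordOcc_one, Fin.forall_fin_one, Matrix.cons_val_zero]
  ring

theorem wordOcc_three_split (hlt : ∀ i j, w (Fin.castAdd b i) < w (Fin.natAdd a j) ↔ D)
    (hgt : ∀ i j, w (Fin.natAdd a j) < w (Fin.castAdd b i) ↔ ¬ D) (p₀ p₁ p₂ : ℕ) :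
    wordOcc ![p₀, p₁, p₂] w = wordOcc ![p₀, p₁, p₂] (w ∘ Fin.castAdd b) +
      (if ∀ x y, (![p₀, p₁] x < ![p₂] y ↔ D) ∧ (![p₂] y < ![p₀, p₁] x ↔ ¬ D) then
        wordOcc ![p₀, p₁] (w ∘ Fin.castAdd b) * b else 0) +
      (if ∀ x y, (![p₀] x < ![p₁, p₂] y ↔ D) ∧ (![p₁, p₂] y < ![p₀] x ↔ ¬ D) then
        a * wordOcc ![p₁, p₂] (w ∘ Fin.natAdd a) else 0) +
      wordOcc ![p₀, p₁, p₂] (w ∘ Fin.natAdd a) := by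
  rw [wordOcc_eq_sum_splitOcc]
  simp only [sum_range_succ, range_zero, sum_empty, zero_add]
  rw [splitOcc_zero _ hlt hgt, splitOcc_self _ hlt hgt,
    splitOcc_append (s := 1) (t := 2) ![p₀] ![p₁, p₂] (by ext i; fin_cases i <;> rfl) hlt hgt,
    splitOcc_append (s := 2) (t := 1) ![p₀, p₁] ![p₂] (by ext i; fin_cases i <;> rfl) hlt hgt]
  simp only [wordOcc_one]
  ring

theorem wordOcc_four_split (hlt : ∀ i j, w (Fin.castAdd b i) < w (Fin.natAdd a j) ↔ D)
    (hgt : ∀ i j, w (Fin.natAdd a j) < w (Fin.castAdd b i) ↔ ¬ D) (p₀ p₁ p₂ p₃ : ℕ) :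
    wordOcc ![p₀, p₁, p₂, p₃] w = wordOcc ![p₀, p₁, p₂, p₃] (w ∘ Fin.castAdd b) +
      (if ∀ x y, (![p₀, p₁, p₂] x < ![p₃] y ↔ D) ∧ (![p₃] y < ![p₀, p₁, p₂] x ↔ ¬ D) then
        wordOcc ![p₀, p₁, p₂] (w ∘ Fin.castAdd b) * b else 0) +
      (if ∀ x y, (![p₀, p₁] x < ![p₂, p₃] y ↔ D) ∧ (![p₂, p₃] y < ![p₀, p₁] x ↔ ¬ D) then
        wordOcc ![p₀, p₁] (w ∘ Fin.castAdd b) * wordOcc ![p₂, p₃] (w ∘ Fin.natAdd a) else 0) +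
      (if ∀ x y, (![p₀] x < ![p₁, p₂, p₃] y ↔ D) ∧ (![p₁, p₂, p₃] y < ![p₀] x ↔ ¬ D) then
        a * wordOcc ![p₁, p₂, p₃] (w ∘ Fin.natAdd a) else 0) +
      wordOcc ![p₀, p₁, p₂, p₃] (w ∘ Fin.natAdd a) := by
  rw [wordOcc_eq_sum_splitOcc]
  simp only [sum_range_succ, range_zero, sum_empty, zero_add]
  rw [splitOcc_zero _ hlt hgt, splitOcc_self _ hlt hgt,
    splitOcc_append (s := 1) (t := 3) ![p₀] ![p₁, p₂, p₃] (by ext i; fin_cases i <;> rfl) hlt hgt,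
    splitOcc_append (s := 2) (t := 2) ![p₀, p₁] ![p₂, p₃] (by ext i; fin_cases i <;> rfl) hlt hgt,
    splitOcc_append (s := 3) (t := 1) ![p₀, p₁, p₂] ![p₃] (by ext i; fin_cases i <;> rfl) hlt hgt]
  simp only [wordOcc_one]
  ring

end Split

/-! ### Coinversions and inversions as counts of 12 and 21 -/

theorem coinv_eq_occr {n : ℕ} (σ : Equiv.Perm (Fin n)) : coinv σ = occr ![1, 2] σ := by
  rw [coinv, occr]
  refine Finset.card_nbij' (fun q => ![q.1, q.2]) (fun f => (f 0, f 1)) ?_ ?_ ?_ ?_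
  · intro q hq
    simp_all [Fin.forall_fin_succ, le_of_lt]
  · intro f hf
    simp_all [Fin.forall_fin_succ]
  · intro q _
    rfl
  · intro f _
    ext i
    fin_cases i <;> rfl

theorem card_filter_fst_lt_snd (n : ℕ) : #{q : Fin n × Fin n | q.1 < q.2} = n.choose 2 := by
  rw [Nat.choose_two_right, ← Finset.sum_range_id, ← Fin.sum_univ_eq_sum_range (fun i => i)]
  rw [Finset.card_filter, Fintype.sum_prod_type_right]
  refine Finset.sum_congr rfl fun j _ => ?_
  rw [← Finset.card_filter]
  change #{x | x < j} = _
  rw [Finset.filter_gt_eq_Iio, Fin.card_Iio]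

theorem coinv_add_occr {n : ℕ} (σ : Equiv.Perm (Fin n)) :
    coinv σ + occr ![2, 1] σ = n.choose 2 := by
  have h : occr ![2, 1] σ = #{q : Fin n × Fin n | q.1 < q.2 ∧ ¬ σ q.1 < σ q.2} := by
    symm
    rw [occr]
    refine Finset.card_nbij' (fun q => ![q.1, q.2]) (fun f => (f 0, f 1)) ?_ ?_ ?_ ?_
    · intro q hq
      simp only [not_lt, coe_filter, mem_univ, true_and, Set.mem_ofPred_eq] at hq
      have h2 : σ q.2 < σ q.1 := hq.2.lt_of_ne (fun h => hq.1.ne' (σ.injective h))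
      simp [Fin.forall_fin_succ, hq.1, h2, hq.2]
    · intro f hf
      simp_all [Fin.forall_fin_succ]
    · intro q _
      rfl
    · intro f _
      ext i
      fin_cases i <;> rfl
  rw [h, coinv, ← card_filter_fst_lt_snd, ← Finset.filter_filter, ← Finset.filter_filter,
    Finset.card_filter_add_card_filter_not]

theorem lt_and_le_iff {x y : ℕ} : x < y ∧ x ≤ y ↔ x < y := and_iff_left_of_imp le_of_lt

theorem le_and_lt_iff {x y : ℕ} : x ≤ y ∧ x < y ↔ x < y := and_iff_right_of_imp le_of_lt

/-! ### Decomposition of 132-avoiding permutations at the maximum -/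

section Join
variable {a b : ℕ}

/-- Positions of a word of length `a + 1 + b`: the first `a`, a middle one, and the last `b`. -/
def joinPos (a b : ℕ) : (Fin a ⊕ Fin 1) ⊕ Fin b ≃ Fin (a + 1 + b) :=
  (Equiv.sumCongr finSumFinEquiv (Equiv.refl _)).trans finSumFinEquiv

/-- Values of a permutation of length `a + 1 + b`, grouped so that the `b` smallest values come
last, and the largest value is in the middle. -/
def joinVal (a b : ℕ) : (Fin a ⊕ Fin 1) ⊕ Fin b ≃ Fin (a + 1 + b) :=
  ((Equiv.sumComm _ _).trans
    ((Equiv.sumCongr (Equiv.refl _) finSumFinEquiv).trans finSumFinEquiv)).trans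
      (finCongr (Nat.add_comm b (a + 1)))

/-- The permutation `τ' m ρ` in one-line notation, where `m` is the maximum and `τ'` is `τ` with
its values shifted above those of `ρ`. -/
def joinPerm (τ : Equiv.Perm (Fin a)) (ρ : Equiv.Perm (Fin b)) : Equiv.Perm (Fin (a + 1 + b)) :=
  (joinPos a b).symm.trans ((Equiv.sumCongr (Equiv.sumCongr τ 1) ρ).trans (joinVal a b))

variable (τ : Equiv.Perm (Fin a)) (ρ : Equiv.Perm (Fin b))

theorem joinPerm_left (i : Fin a) :
    (joinPerm τ ρ (Fin.castAdd b (Fin.castAdd 1 i)) : ℕ) = b + τ i := by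
  have : Fin.castAdd b (Fin.castAdd 1 i) = joinPos a b (Sum.inl (Sum.inl i)) := rfl
  rw [this]
  simp [joinPerm, joinVal, Nat.add_comm]

theorem joinPerm_mid (i : Fin 1) :
    (joinPerm τ ρ (Fin.castAdd b (Fin.natAdd a i)) : ℕ) = b + a := by
  have : Fin.castAdd b (Fin.natAdd a i) = joinPos a b (Sum.inl (Sum.inr i)) := rfl
  rw [this]
  simp [joinPerm, joinVal, Nat.add_comm]

theorem joinPerm_right (i : Fin b) : (joinPerm τ ρ (Fin.natAdd (a + 1) i) : ℕ) = ρ i := by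
  have : Fin.natAdd (a + 1) i = joinPos a b (Sum.inr i) := rfl
  rw [this]
  simp [joinPerm, joinVal]

theorem joinPerm_injective {τ τ' : Equiv.Perm (Fin a)} {ρ ρ' : Equiv.Perm (Fin b)}
    (h : joinPerm τ ρ = joinPerm τ' ρ') : τ = τ' ∧ ρ = ρ' := by
  constructor
  · ext i
    have := joinPerm_left τ ρ i
    rw [h, joinPerm_left] at this
    omega
  · ext i
    have := joinPerm_right τ ρ i
    rw [h, joinPerm_right] at this
    omega

theorem lt_of_avoid132 {n : ℕ} {σ : Equiv.Perm (Fin n)} (h : occr ![1, 3, 2] σ = 0)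
    {x y z : Fin n} (hxy : x < y) (hyz : y < z) (hzy : σ z < σ y) : σ z < σ x := by
  rw [occr, Finset.card_eq_zero, Finset.filter_eq_empty_iff] at h
  have hne : σ z ≠ σ x := fun e => (hxy.trans hyz).ne' (σ.injective e)
  by_contra hlt
  have hxz : σ x < σ z := lt_of_le_of_ne (not_lt.1 hlt) hne.symm
  have hxy' := hxz.trans hzy
  refine h (mem_univ ![x, y, z]) ?_
  simp [Fin.forall_fin_succ, hxy, hyz, hxy.trans hyz, hzy, hxz, hxy', hzy.le, hxz.le, hxy'.le]

/-- Avoidance puts the `b` letters after the maximum below all others. In the block coordinates of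
`joinPos` and `joinVal`, `σ` then preserves the first summand, and it fixes the maximum, so it
splits twice as a sum of permutations. -/
theorem exists_joinPerm_eq {σ : Equiv.Perm (Fin (a + 1 + b))} (h : occr ![1, 3, 2] σ = 0)
    (hmax : (σ (Fin.castAdd b (Fin.natAdd a 0)) : ℕ) = b + a) :
    ∃ τ ρ, joinPerm (a := a) (b := b) τ ρ = σ := by
  set y : Fin (a + 1 + b) := Fin.castAdd b (Fin.natAdd a 0) with hy
  have hlast (z) (hz : z ≠ y) : σ z < σ y := by
    have h1 : σ z ≠ σ y := fun e => hz (σ.injective e)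
    have h2 := (σ z).2
    rw [Fin.lt_def]
    rw [Ne, Fin.ext_iff] at h1
    omega
  have hge (x : Fin (a + 1)) : b ≤ (σ (Fin.castAdd b x) : ℕ) := by
    have hlt (j : Fin b) : σ (Fin.natAdd (a + 1) j) < σ (Fin.castAdd b x) := by
      have hyj : y < Fin.natAdd (a + 1) j := by rw [Fin.lt_def]; simp [hy]; omega
      rcases (Nat.lt_succ_iff.1 x.2).lt_or_eq with hx | hx
      · exact lt_of_avoid132 h (by rw [Fin.lt_def]; simpa [hy] using hx) hyj (hlast _ hyj.ne')
      · have : Fin.castAdd b x = y := by ext; simpa [hy] using hx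
        rw [this]
        exact hlast _ hyj.ne'
    -- The `b` distinct values to the right all lie below the value at `x`, which is therefore at
    -- least `b`.
    let f : Fin b → Fin (σ (Fin.castAdd b x) : ℕ) :=
      fun j => ⟨σ (Fin.natAdd (a + 1) j), hlt j⟩
    have hf : Function.Injective f := by
      intro i j hij
      have := congrArg Fin.val hij
      simpa [f, Fin.val_inj] using this
    simpa using Fintype.card_le_of_injective f hf
  let g : Equiv.Perm ((Fin a ⊕ Fin 1) ⊕ Fin b) :=
    (joinPos a b).trans (σ.trans (joinVal a b).symm)
  have hgσ (x) : joinVal a b (g x) = σ (joinPos a b x) := by simp [g]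
  have hg : Set.MapsTo g (Set.range Sum.inl) (Set.range Sum.inl) := by
    rintro _ ⟨x, rfl⟩
    rcases hx : g (Sum.inl x) with z | z
    · exact ⟨z, rfl⟩
    · exfalso
      have h1 := hgσ (Sum.inl x)
      rw [hx] at h1
      have h2 : b ≤ (σ (joinPos a b (Sum.inl x)) : ℕ) := hge (finSumFinEquiv x)
      rw [← h1] at h2
      have := z.2
      simp [joinVal] at h2
      omega
  obtain ⟨⟨g₁, ρ⟩, hg₁⟩ := Equiv.Perm.mem_sumCongrHom_range_of_perm_mapsTo_inl hg
  have hmid : g (Sum.inl (Sum.inr 0)) = Sum.inl (Sum.inr 0) := by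
    apply (joinVal a b).injective
    rw [hgσ]
    ext
    exact hmax.trans (by simp [joinVal, Nat.add_comm])
  have hmid₁ : g₁ (Sum.inr 0) = Sum.inr 0 := by
    rw [← hg₁] at hmid
    simpa using hmid
  have hg₁' : Set.MapsTo g₁ (Set.range Sum.inl) (Set.range Sum.inl) := by
    rintro _ ⟨x, rfl⟩
    rcases hx : g₁ (Sum.inl x) with z | z
    · exact ⟨z, rfl⟩
    · rw [Subsingleton.elim z 0, ← hmid₁] at hx
      exact absurd (g₁.injective hx) (by simp)
  obtain ⟨⟨τ, e⟩, hτ⟩ := Equiv.Perm.mem_sumCongrHom_range_of_perm_mapsTo_inl hg₁'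
  refine ⟨τ, ρ, ?_⟩
  obtain rfl : e = 1 := Subsingleton.elim _ _
  have hgg : g = Equiv.sumCongr (Equiv.sumCongr τ 1) ρ := by
    rw [← hg₁, ← hτ]
    rfl
  ext i
  simp [joinPerm, ← hgg, g]

/-! ### Pattern counts of the joined permutation -/

theorem joinPerm_right_lt (i : Fin (a + 1)) (j : Fin b) :
    (joinPerm τ ρ (Fin.natAdd (a + 1) j) : ℕ) < joinPerm τ ρ (Fin.castAdd b i) := by
  rw [joinPerm_right]
  refine (ρ j).2.trans_le ?_
  induction i using Fin.addCases with
  | left i => rw [joinPerm_left]; omega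
  | right i => rw [joinPerm_mid]; omega

/-- The part of the word of `joinPerm τ ρ` up to its maximum. -/
def joinHead (i : Fin (a + 1)) : ℕ := joinPerm τ ρ (Fin.castAdd b i)

theorem wordOcc_joinPerm_right {m : ℕ} (p : Fin m → ℕ) :
    wordOcc p ((fun i => (joinPerm τ ρ i : ℕ)) ∘ Fin.natAdd (a + 1)) = occr p ρ := by
  rw [occr_eq_wordOcc]
  refine wordOcc_congr (fun _ _ => Iff.rfl) fun x y => ?_
  simp [joinPerm_right]

theorem wordOcc_joinHead_left {m : ℕ} (p : Fin m → ℕ) :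
    wordOcc p (joinHead τ ρ ∘ Fin.castAdd 1) = occr p τ := by
  rw [occr_eq_wordOcc]
  refine wordOcc_congr (fun _ _ => Iff.rfl) fun x y => ?_
  simp [joinHead, joinPerm_left]

theorem joinHead_lt (i : Fin a) (j : Fin 1) :
    joinHead τ ρ (Fin.castAdd 1 i) < joinHead τ ρ (Fin.natAdd a j) := by
  rw [joinHead, joinHead, joinPerm_left, joinPerm_mid]
  omega

theorem wordOcc_joinHead_two (p₀ p₁ : ℕ) :
    wordOcc ![p₀, p₁] (joinHead τ ρ) = occr ![p₀, p₁] τ + if p₀ < p₁ then a else 0 := by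
  rw [wordOcc_two_split (D := True) (fun i j => iff_true_intro (joinHead_lt τ ρ i j))
    (fun i j => by simpa using (joinHead_lt τ ρ i j).le), wordOcc_joinHead_left,
    -- The right block is the maximum alone, too short for a two-letter pattern.
    wordOcc_eq_zero_of_lt (by omega)]
  by_cases h : p₀ < p₁ <;> simp [h, le_of_lt]

theorem wordOcc_joinHead_three (p₀ p₁ p₂ : ℕ) :
    wordOcc ![p₀, p₁, p₂] (joinHead τ ρ) = occr ![p₀, p₁, p₂] τ +
      if p₀ < p₂ ∧ p₁ < p₂ then occr ![p₀, p₁] τ else 0 := by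
  rw [wordOcc_three_split (D := True) (fun i j => iff_true_intro (joinHead_lt τ ρ i j))
    (fun i j => by simpa using (joinHead_lt τ ρ i j).le), wordOcc_joinHead_left,
    wordOcc_joinHead_left, wordOcc_eq_zero_of_lt (by omega), wordOcc_eq_zero_of_lt (by omega)]
  simp [Fin.forall_fin_succ, lt_and_le_iff]

theorem wordOcc_joinHead_four (p₀ p₁ p₂ p₃ : ℕ) :
    wordOcc ![p₀, p₁, p₂, p₃] (joinHead τ ρ) = occr ![p₀, p₁, p₂, p₃] τ +
      if p₀ < p₃ ∧ p₁ < p₃ ∧ p₂ < p₃ then occr ![p₀, p₁, p₂] τ else 0 := by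
  rw [wordOcc_four_split (D := True) (fun i j => iff_true_intro (joinHead_lt τ ρ i j))
    (fun i j => by simpa using (joinHead_lt τ ρ i j).le), wordOcc_joinHead_left,
    wordOcc_joinHead_left, wordOcc_joinHead_left, wordOcc_eq_zero_of_lt (by omega),
    wordOcc_eq_zero_of_lt (by omega), wordOcc_eq_zero_of_lt (by omega)]
  simp [Fin.forall_fin_succ, lt_and_le_iff]

theorem occr_joinPerm_two (p₀ p₁ : ℕ) :
    occr ![p₀, p₁] (joinPerm τ ρ) = (occr ![p₀, p₁] τ + if p₀ < p₁ then a else 0) +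
      (if p₁ < p₀ then (a + 1) * b else 0) + occr ![p₀, p₁] ρ := by
  rw [occr_eq_wordOcc, wordOcc_two_split (D := False)
    (fun i j => by simpa using (joinPerm_right_lt τ ρ i j).le)
    (fun i j => by simpa using (joinPerm_right_lt τ ρ i j)), wordOcc_joinPerm_right]
  change wordOcc _ (joinHead τ ρ) + _ + _ = _
  rw [wordOcc_joinHead_two]
  by_cases h : p₁ < p₀ <;> simp [h, le_of_lt]

theorem occr_joinPerm_three (p₀ p₁ p₂ : ℕ) :
    occr ![p₀, p₁, p₂] (joinPerm τ ρ) =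
      (occr ![p₀, p₁, p₂] τ + if p₀ < p₂ ∧ p₁ < p₂ then occr ![p₀, p₁] τ else 0) +
      (if p₂ < p₀ ∧ p₂ < p₁ then (occr ![p₀, p₁] τ + if p₀ < p₁ then a else 0) * b else 0) +
      (if p₁ < p₀ ∧ p₂ < p₀ then (a + 1) * occr ![p₁, p₂] ρ else 0) +
      occr ![p₀, p₁, p₂] ρ := by
  rw [occr_eq_wordOcc, wordOcc_three_split (D := False)
    (fun i j => by simpa using (joinPerm_right_lt τ ρ i j).le)
    (fun i j => by simpa using (joinPerm_right_lt τ ρ i j)), wordOcc_joinPerm_right,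
    wordOcc_joinPerm_right]
  change wordOcc _ (joinHead τ ρ) + (if _ then wordOcc _ (joinHead τ ρ) * _ else 0) + _ + _ = _
  rw [wordOcc_joinHead_two, wordOcc_joinHead_three]
  simp [Fin.forall_fin_succ, le_and_lt_iff]

theorem occr_joinPerm_four (p₀ p₁ p₂ p₃ : ℕ) :
    occr ![p₀, p₁, p₂, p₃] (joinPerm τ ρ) =
      (occr ![p₀, p₁, p₂, p₃] τ +
        if p₀ < p₃ ∧ p₁ < p₃ ∧ p₂ < p₃ then occr ![p₀, p₁, p₂] τ else 0) +
      (if p₃ < p₀ ∧ p₃ < p₁ ∧ p₃ < p₂ then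
        (occr ![p₀, p₁, p₂] τ + if p₀ < p₂ ∧ p₁ < p₂ then occr ![p₀, p₁] τ else 0) * b else 0) +
      (if (p₂ < p₀ ∧ p₃ < p₀) ∧ p₂ < p₁ ∧ p₃ < p₁ then
        (occr ![p₀, p₁] τ + if p₀ < p₁ then a else 0) * occr ![p₂, p₃] ρ else 0) +
      (if p₁ < p₀ ∧ p₂ < p₀ ∧ p₃ < p₀ then (a + 1) * occr ![p₁, p₂, p₃] ρ else 0) +
      occr ![p₀, p₁, p₂, p₃] ρ := by
  rw [occr_eq_wordOcc, wordOcc_four_split (D := False)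
    (fun i j => by simpa using (joinPerm_right_lt τ ρ i j).le)
    (fun i j => by simpa using (joinPerm_right_lt τ ρ i j)), wordOcc_joinPerm_right,
    wordOcc_joinPerm_right, wordOcc_joinPerm_right]
  change wordOcc _ (joinHead τ ρ) + (if _ then wordOcc _ (joinHead τ ρ) * _ else 0) +
    (if _ then wordOcc _ (joinHead τ ρ) * _ else 0) + _ + _ = _
  rw [wordOcc_joinHead_two, wordOcc_joinHead_three, wordOcc_joinHead_four]
  simp [Fin.forall_fin_succ, le_and_lt_iff]

theorem occr_congr_pattern {m n : ℕ} {p : Fin m → ℕ} (q : Fin m → ℕ) (σ : Equiv.Perm (Fin n))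
    (hp : ∀ a b, p a < p b ↔ q a < q b) : occr p σ = occr q σ :=
  by simpa only [occr_eq_wordOcc] using wordOcc_congr_pattern q hp

end Join

/-! ### Multiplicativity of the weights -/

section Weight
variable {R : Type*} [CommRing R]

/-- The monomial recording the pattern counts of `σ`, evaluated at `x` and `y`. -/
def permWeight {n : ℕ} (x : Fin 5 → R) (y : Fin 14 → R) (σ : Equiv.Perm (Fin n)) : R :=
  (∏ a : Fin 5, x a ^ occr (pattern3 a) σ) * ∏ b : Fin 14, y b ^ occr (pattern4 b) σ

theorem Qeval_eq_sum (n : ℕ) (i : ℤ) (x : Fin 5 → R) (y : Fin 14 → R) :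
    Qeval n i x y = ∑ σ ∈ avoid132 n with (coinv σ : ℤ) = i, permWeight x y σ := by
  simp [Qeval, Qpoly, permWeight, map_sum, map_prod]

theorem permWeight_eq {n : ℕ} (σ : Equiv.Perm (Fin n))
    (x₁ x₂ x₃ x₄ x₅ y₁ y₂ y₃ y₄ y₅ y₆ y₇ y₈ y₉ y₁₀ y₁₁ y₁₂ y₁₃ y₁₄ : R) :
    permWeight ![x₁, x₂, x₃, x₄, x₅]
      ![y₁, y₂, y₃, y₄, y₅, y₆, y₇, y₈, y₉, y₁₀, y₁₁, y₁₂, y₁₃, y₁₄] σ =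
    x₁ ^ occr ![1, 2, 3] σ * x₂ ^ occr ![2, 1, 3] σ * x₃ ^ occr ![2, 3, 1] σ *
    x₄ ^ occr ![3, 1, 2] σ * x₅ ^ occr ![3, 2, 1] σ * y₁ ^ occr ![1, 2, 3, 4] σ *
    y₂ ^ occr ![2, 1, 3, 4] σ * y₃ ^ occr ![2, 3, 1, 4] σ * y₄ ^ occr ![2, 3, 4, 1] σ *
    y₅ ^ occr ![3, 1, 2, 4] σ * y₆ ^ occr ![3, 2, 1, 4] σ * y₇ ^ occr ![3, 2, 4, 1] σ *
    y₈ ^ occr ![3, 4, 1, 2] σ * y₉ ^ occr ![3, 4, 2, 1] σ * y₁₀ ^ occr ![4, 1, 2, 3] σ *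
    y₁₁ ^ occr ![4, 2, 1, 3] σ * y₁₂ ^ occr ![4, 2, 3, 1] σ * y₁₃ ^ occr ![4, 3, 1, 2] σ *
    y₁₄ ^ occr ![4, 3, 2, 1] σ := by
  simp only [permWeight, pattern3, pattern4, Fin.prod_univ_succ, Fin.prod_univ_zero,
    Matrix.cons_val_zero, Matrix.cons_val_succ, mul_one, mul_assoc]

theorem permWeight_joinPerm {a b : ℕ} (τ : Equiv.Perm (Fin a)) (ρ : Equiv.Perm (Fin b))
    (x₁ x₂ x₃ x₄ x₅ y₁ y₂ y₃ y₄ y₅ y₆ y₇ y₈ y₉ y₁₀ y₁₁ y₁₂ y₁₃ y₁₄ : R) {j c l d : ℕ}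
    (hj : occr ![1, 2] τ = j) (hc : occr ![2, 1] τ = c) (hl : occr ![1, 2] ρ = l)
    (hd : occr ![2, 1] ρ = d) :
    permWeight ![x₁, x₂, x₃, x₄, x₅]
      ![y₁, y₂, y₃, y₄, y₅, y₆, y₇, y₈, y₉, y₁₀, y₁₁, y₁₂, y₁₃, y₁₄] (joinPerm τ ρ) =
    x₁ ^ j * x₂ ^ c * x₃ ^ (b * (a + j)) * x₄ ^ ((a + 1) * l) * x₅ ^ (b * c + (a + 1) * d) *
    y₄ ^ (j * b) * y₇ ^ (c * b) * y₈ ^ ((j + a) * l) * y₉ ^ ((j + a) * d) * y₁₃ ^ (c * l) *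
    y₁₄ ^ (c * d) *
    permWeight ![x₁ * y₁ * y₄ ^ b, x₂ * y₂ * y₇ ^ b, x₃ * y₃ * y₉ ^ b, x₄ * y₅ * y₁₂ ^ b,
      x₅ * y₆ * y₁₄ ^ b]
      ![y₁, y₂, y₃, y₄, y₅, y₆, y₇, y₈, y₉, y₁₀, y₁₁, y₁₂, y₁₃, y₁₄] τ *
    permWeight ![x₁ * y₁₀ ^ (a + 1), x₂ * y₁₁ ^ (a + 1), x₃ * y₁₂ ^ (a + 1),
      x₄ * y₁₃ ^ (a + 1), x₅ * y₁₄ ^ (a + 1)]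
      ![y₁, y₂, y₃, y₄, y₅, y₆, y₇, y₈, y₉, y₁₀, y₁₁, y₁₂, y₁₃, y₁₄] ρ := by
  -- Prefixes cut from longer patterns, such as 34 in 3412, are standardized to the tracked
  -- patterns.
  have e23 : occr ![2, 3] τ = j := (occr_congr_pattern _ τ (by decide)).trans hj
  have e34 : occr ![3, 4] τ = j := (occr_congr_pattern _ τ (by decide)).trans hj
  have e32 : occr ![3, 2] τ = c := (occr_congr_pattern _ τ (by decide)).trans hc
  have e43 : occr ![4, 3] τ = c := (occr_congr_pattern _ τ (by decide)).trans hc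
  have e234 := occr_congr_pattern (p := ![2, 3, 4]) ![1, 2, 3] τ (by decide)
  have e324 := occr_congr_pattern (p := ![3, 2, 4]) ![2, 1, 3] τ (by decide)
  have e342 := occr_congr_pattern (p := ![3, 4, 2]) ![2, 3, 1] τ (by decide)
  have e423 := occr_congr_pattern (p := ![4, 2, 3]) ![3, 1, 2] τ (by decide)
  have e432 := occr_congr_pattern (p := ![4, 3, 2]) ![3, 2, 1] τ (by decide)
  simp only [permWeight_eq, occr_joinPerm_three, occr_joinPerm_four]
  norm_num only [e23, e34, e32, e43, e234, e324, e342, e423, e432, hj, hc, hl, hd]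
  simp only [if_true, if_false, and_true, and_false, and_self, add_zero]
  generalize occr ![1, 2, 3] τ = t1
  generalize occr ![2, 1, 3] τ = t2
  generalize occr ![2, 3, 1] τ = t3
  generalize occr ![3, 1, 2] τ = t4
  generalize occr ![3, 2, 1] τ = t5
  generalize occr ![1, 2, 3] ρ = r1
  generalize occr ![2, 1, 3] ρ = r2
  generalize occr ![2, 3, 1] ρ = r3
  generalize occr ![3, 1, 2] ρ = r4
  generalize occr ![3, 2, 1] ρ = r5
  ring
end Weight

/-! ### Reindexing the sum and the recursion -/

theorem coinv_joinPerm {a b : ℕ} (τ : Equiv.Perm (Fin a)) (ρ : Equiv.Perm (Fin b)) :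
    coinv (joinPerm τ ρ) = coinv τ + a + coinv ρ := by
  simp [coinv_eq_occr, occr_joinPerm_two]

/-- No crossing term survives: in 132 the last letter is neither the largest nor the smallest, and
the first is not the largest. -/
theorem occr_132_joinPerm {a b : ℕ} (τ : Equiv.Perm (Fin a)) (ρ : Equiv.Perm (Fin b)) :
    occr ![1, 3, 2] (joinPerm τ ρ) = occr ![1, 3, 2] τ + occr ![1, 3, 2] ρ := by
  simp [occr_joinPerm_three]

theorem sum_avoid132_max_at {M : Type*} [AddCommMonoid M] {a b : ℕ} (i : ℤ)
    (hn : a + 1 + b - 1 < a + 1 + b) (F : Equiv.Perm (Fin (a + 1 + b)) → M) :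
    ∑ σ ∈ avoid132 (a + 1 + b) with (coinv σ : ℤ) = i ∧
      (σ.symm ⟨a + 1 + b - 1, hn⟩ : ℕ) + 1 = a + 1, F σ =
    ∑ q ∈ avoid132 a ×ˢ avoid132 b with (coinv q.1 : ℤ) + a + coinv q.2 = i,
      F (joinPerm q.1 q.2) := by
  have key (σ : Equiv.Perm (Fin (a + 1 + b))) : (σ.symm ⟨a + 1 + b - 1, hn⟩ : ℕ) + 1 = a + 1 ↔
      (σ (Fin.castAdd b (Fin.natAdd a 0)) : ℕ) = b + a := by
    have h1 : (σ.symm ⟨a + 1 + b - 1, hn⟩ : ℕ) + 1 = a + 1 ↔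
        σ.symm ⟨a + 1 + b - 1, hn⟩ = Fin.castAdd b (Fin.natAdd a 0) := by
      rw [Fin.ext_iff]; simp
    rw [h1, Equiv.symm_apply_eq, Fin.ext_iff]
    simp only
    omega
  symm
  refine Finset.sum_bij (fun q _ => joinPerm q.1 q.2) ?_ ?_ ?_ ?_
  · rintro ⟨τ, ρ⟩ h
    simp only [avoid132, mem_filter, mem_product, mem_univ, true_and] at h ⊢
    refine ⟨by rw [occr_132_joinPerm, h.1.1, h.1.2], ?_, ?_⟩
    · rw [coinv_joinPerm]
      exact_mod_cast h.2
    · rw [key, joinPerm_mid]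
  · rintro ⟨τ, ρ⟩ - ⟨τ', ρ'⟩ - h
    obtain ⟨rfl, rfl⟩ := joinPerm_injective h
    rfl
  · intro σ hσ
    simp only [avoid132, mem_filter, mem_univ, true_and, key] at hσ
    obtain ⟨τ, ρ, rfl⟩ := exists_joinPerm_eq hσ.1 hσ.2.2
    rw [occr_132_joinPerm, coinv_joinPerm] at hσ
    refine ⟨(τ, ρ), ?_, rfl⟩
    simp only [avoid132, mem_filter, mem_product, mem_univ, true_and]
    exact ⟨by omega, by exact_mod_cast hσ.2.1⟩
  · intros
    rfl

theorem Qpoly_zero_zero : Qpoly 0 0 = 1 := by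
  have h0 {m : ℕ} (p : Fin (m + 1) → ℕ) (σ : Equiv.Perm (Fin 0)) : occr p σ = 0 := by
    rw [occr_eq_wordOcc, wordOcc_eq_zero_of_lt (Nat.succ_pos m)]
  have h1 (σ : Equiv.Perm (Fin 0)) : coinv σ = 0 := by rw [coinv_eq_occr, h0]
  simp [Qpoly, avoid132, h0, h1]

theorem Qpoly_eq_zero (n : ℕ) (i : ℤ) (h : i < 0 ∨ (n.choose 2 : ℤ) < i) : Qpoly n i = 0 := by
  rw [Qpoly, Finset.filter_false_of_mem, Finset.sum_empty]
  intro σ _ hσ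
  have := coinv_add_occr σ
  omega

/-- The recursion is an identity between values at arbitrary elements of an arbitrary commutative
ring, in particular at the variables of the polynomial ring over `ℤ`. The exponents of the monomial
prefactors are computed in `ℤ`; when a factor `binom(k-1,2) - j` or
`binom(n-k,2) + k + j - i - 1` is negative, one of the two `Q` factors of the term vanishes,
so the value of `Int.toNat` there is irrelevant. -/
theorem mainTheorem3 :
    Qpoly 0 0 = 1 ∧
    (∀ (n : ℕ) (i : ℤ), i < 0 ∨ (n.choose 2 : ℤ) < i → Qpoly n i = 0) ∧
    ∀ (n : ℕ) (i : ℤ), 1 ≤ n →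
      ∀ {R : Type*} [CommRing R]
        (x₁ x₂ x₃ x₄ x₅ y₁ y₂ y₃ y₄ y₅ y₆ y₇ y₈ y₉ y₁₀ y₁₁ y₁₂ y₁₃ y₁₄ : R),
        Qeval n i ![x₁, x₂, x₃, x₄, x₅]
            ![y₁, y₂, y₃, y₄, y₅, y₆, y₇, y₈, y₉, y₁₀, y₁₁, y₁₂, y₁₃, y₁₄] =
          ∑ k ∈ Finset.Icc 1 n, ∑ j ∈ Finset.Icc (0 : ℤ) (i + 1 - k),
            x₁ ^ j.toNat *
            x₂ ^ (((k - 1).choose 2 : ℤ) - j).toNat *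
            x₃ ^ (((n : ℤ) - k) * (k + j - 1)).toNat *
            x₄ ^ ((k : ℤ) * (i + 1 - k - j)).toNat *
            x₅ ^ (((n : ℤ) - k) * (((k - 1).choose 2 : ℤ) - j) +
                  k * (((n - k).choose 2 : ℤ) + k + j - i - 1)).toNat *
            y₄ ^ (j * ((n : ℤ) - k)).toNat *
            y₇ ^ ((((k - 1).choose 2 : ℤ) - j) * ((n : ℤ) - k)).toNat *
            y₈ ^ ((j + k - 1) * (i + 1 - k - j)).toNat *
            y₉ ^ ((j + k - 1) * (((n - k).choose 2 : ℤ) + k + j - i - 1)).toNat *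
            y₁₃ ^ ((((k - 1).choose 2 : ℤ) - j) * (i + 1 - k - j)).toNat *
            y₁₄ ^ ((((k - 1).choose 2 : ℤ) - j) *
                  (((n - k).choose 2 : ℤ) + k + j - i - 1)).toNat *
            Qeval (k - 1) j
              ![x₁ * y₁ * y₄ ^ (n - k), x₂ * y₂ * y₇ ^ (n - k), x₃ * y₃ * y₉ ^ (n - k),
                x₄ * y₅ * y₁₂ ^ (n - k), x₅ * y₆ * y₁₄ ^ (n - k)]
              ![y₁, y₂, y₃, y₄, y₅, y₆, y₇, y₈, y₉, y₁₀, y₁₁, y₁₂, y₁₃, y₁₄] *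
            Qeval (n - k) (i + 1 - k - j)
              ![x₁ * y₁₀ ^ k, x₂ * y₁₁ ^ k, x₃ * y₁₂ ^ k, x₄ * y₁₃ ^ k, x₅ * y₁₄ ^ k]
              ![y₁, y₂, y₃, y₄, y₅, y₆, y₇, y₈, y₉, y₁₀, y₁₁, y₁₂, y₁₃, y₁₄] := by
  refine ⟨Qpoly_zero_zero, Qpoly_eq_zero, ?_⟩
  intro n i hn R _ x₁ x₂ x₃ x₄ x₅ y₁ y₂ y₃ y₄ y₅ y₆ y₇ y₈ y₉ y₁₀ y₁₁ y₁₂ y₁₃ y₁₄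
  have hn' : n - 1 < n := by omega
  rw [Qeval_eq_sum, ← Finset.sum_fiberwise_of_maps_to (t := Finset.Icc 1 n)
    -- Here `k` is the position of the maximum, counted from one.
    (g := fun σ => (σ.symm ⟨n - 1, hn'⟩ : ℕ) + 1)
    (fun σ _ => by simp)]
  refine Finset.sum_congr rfl fun k hk => ?_
  rw [Finset.mem_Icc] at hk
  obtain ⟨a, rfl⟩ : ∃ a, k = a + 1 := ⟨k - 1, by omega⟩
  obtain ⟨b, rfl⟩ : ∃ b, n = a + 1 + b := ⟨n - (a + 1), by omega⟩
  rw [Finset.filter_filter, sum_avoid132_max_at i hn',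
    ← Finset.sum_fiberwise_of_maps_to (t := Finset.Icc (0 : ℤ) (i + 1 - (a + 1 : ℕ)))
      (g := fun q => (coinv q.1 : ℤ))]
  swap
  · intro q hq
    rw [Finset.mem_filter] at hq
    rw [Finset.mem_Icc]
    omega
  refine Finset.sum_congr rfl fun j hj => ?_
  rw [Nat.add_sub_cancel, Nat.add_sub_cancel_left, Qeval_eq_sum, Qeval_eq_sum, Finset.filter_filter]
  have hS : {q ∈ avoid132 a ×ˢ avoid132 b |
        (coinv q.1 : ℤ) + a + coinv q.2 = i ∧ (coinv q.1 : ℤ) = j} =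
      {τ ∈ avoid132 a | (coinv τ : ℤ) = j} ×ˢ
        {ρ ∈ avoid132 b | (coinv ρ : ℤ) = i + 1 - (a + 1 : ℕ) - j} := by
    ext q
    simp only [Finset.mem_filter, Finset.mem_product]
    constructor
    · rintro ⟨⟨h1, h2⟩, h3, h4⟩
      exact ⟨⟨h1, h4⟩, h2, by omega⟩
    · rintro ⟨⟨h1, h4⟩, h2, h3⟩
      exact ⟨⟨h1, h2⟩, by omega, h4⟩
  rw [hS, mul_assoc, Finset.sum_mul_sum, ← Finset.sum_product', Finset.mul_sum]
  refine Finset.sum_congr rfl fun q hq => ?_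
  obtain ⟨τ, ρ⟩ := q
  simp only [Finset.mem_product, Finset.mem_filter] at hq
  have hτ := hq.1.2
  have hρ := hq.2.2
  have hc := coinv_add_occr τ
  have hd := coinv_add_occr ρ
  rw [permWeight_joinPerm τ ρ _ _ _ _ _ _ _ _ _ _ _ _ _ _ _ _ _ _ _ (coinv_eq_occr τ).symm rfl
    (coinv_eq_occr ρ).symm rfl]
  -- For an actual pair `τ`, `ρ` the integer exponents are natural-number counts, so `Int.toNat`
  -- loses nothing; for indices without such a pair both sums are empty.
  have hc' : (a.choose 2 : ℤ) - j = (occr ![2, 1] τ : ℕ) := by omega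
  have hd' : (b.choose 2 : ℤ) + (a + 1 : ℕ) + j - i - 1 = (occr ![2, 1] ρ : ℕ) := by omega
  have hb : ((a + 1 + b : ℕ) : ℤ) - (a + 1 : ℕ) = (b : ℕ) := by omega
  have ha : ((a + 1 : ℕ) : ℤ) + j - 1 = (a + coinv τ : ℕ) := by omega
  have ha' : j + ((a + 1 : ℕ) : ℤ) - 1 = (coinv τ + a : ℕ) := by omega
  rw [hc', hd', hb, ha, ha', ← hρ, ← hτ]
  simp only [← Nat.cast_mul, ← Nat.cast_add, Int.toNat_natCast, mul_assoc]
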